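/- Let $n\ge 2$ and let $Q_n=\langle x,y : x^{2n}=1,\ x^n=y^2,\ yx=x^{-1}y\rangle$ be the dicyclic group of order $4n$. Let $\Gamma(Q_n)$ be its generating graph: the vertices are the elements of $Q_n$, and two distinct elements $g,h$ are adjacent if and only if $\langle g,h\rangle=Q_n$. Let $\Omega=\{x^b y : 0\le b\le 2n-1\}$, and let $A_{11}$ be the $2n\times 2n$ adjacency matrix of the subgraph $\Gamma_\Omega$ of $\Gamma(Q_n)$ induced by $\Omega$. Let $n_0$ be the product of the distinct primes dividing $n$, and let $1=d_1<d_2<\dots<d_{2^k}=n_0$ be the divisors of $n_0$. Then the spectrum of $A_{11}$ (the multiset of its eigenvalues, i.e. of the roots of its characteristic polynomial over $\mathbb R$, with multiplicity) is $$\mathrm{Spec}_{A_{11}}=\begin{pmatrix} 0&2\varphi(n)&2\mu(d_2)\frac{\varphi(n)}{\varphi(d_2)}&2\mu(d_3)\frac{\varphi(n)}{\varphi(d_3)}&\cdots&2\mu(d_{2^k})\frac{\varphi(n)}{\varphi(d_{2^k})}\\[2pt] 2n-n_0&1&\varphi(d_2)&\varphi(d_3)&\cdots&\varphi(d_{2^k})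 \end{pmatrix},$$ where the first row lists eigenvalues and the second their multiplicities (multiplicities of equal entries of the first row are added), $\varphi$ is Euler's totient function and $\mu$ is the Möbius function. -/

import Mathlib

/-- The generating graph of a group `G`: the vertices are the elements of `G`, and two distinct
elements are adjacent if and only if together they generate `G`. -/
def generatingGraph (G : Type*) [Group G] : SimpleGraph G where
  Adj g h := g ≠ h ∧ Subgroup.closure {g, h} = ⊤
  symm := ⟨fun _ _ hgh => ⟨hgh.1.symm, by rw [Set.pair_comm]; exact hgh.2⟩⟩
  loopless := ⟨fun _ hg => hg.1 rfl⟩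

namespace Dicyclic

/-- The generator `x` of the dicyclic group `Qₙ` of order `4n`. Mathlib's `QuaternionGroup n` is
`⟨x, y : x ^ (2n) = 1, x ^ n = y ^ 2, y x = x⁻¹ y⟩`. -/
def x (n : ℕ) : QuaternionGroup n := QuaternionGroup.a 1

/-- The generator `y` of the dicyclic group `Qₙ`. -/
def y (n : ℕ) : QuaternionGroup n := QuaternionGroup.xa 0

theorem x_pow_two_mul (n : ℕ) : x n ^ (2 * n) = 1 := QuaternionGroup.a_one_pow_n

theorem x_pow_eq_y_sq (n : ℕ) : x n ^ n = y n ^ 2 := by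
  rw [x, y, QuaternionGroup.a_one_pow, QuaternionGroup.xa_sq]

theorem y_mul_x (n : ℕ) : y n * x n = (x n)⁻¹ * y n := by
  rw [eq_inv_mul_iff_mul_eq, x, y, QuaternionGroup.xa_mul_a, QuaternionGroup.a_mul_xa]
  simp

/-- The set `Ω = {x ^ b y : 0 ≤ b ≤ 2n - 1}`. -/
def Omega (n : ℕ) : Set (QuaternionGroup n) :=
  {g | ∃ b : ℕ, b < 2 * n ∧ g = x n ^ b * y n}

/-- The subgraph of the generating graph of `Qₙ` induced by `Ω`. -/
abbrev graphOmega (n : ℕ) : SimpleGraph (Omega n) :=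
  (generatingGraph (QuaternionGroup n)).induce (Omega n)

end Dicyclic

open Finset

/-! Index `Ω` by residues mod `2n`. Two of its elements generate the group iff the difference of
their indices is coprime to `n` (`closure_xa_xa_eq_top_iff`), so the matrix is circulant and the
additive characters diagonalise it (`ZMod.charpoly_of_sub`). The character of a residue of additive
order `d` has as eigenvalue the sum of `z ^ a` over `a < 2n` coprime to `n`, with `z` a primitive
`d`-th root of unity. This is twice a Ramanujan sum if `d ∣ n` and `0` otherwise
(`sum_pow_coprime_two_mul`). Each `d ∣ 2n` occurs `φ(d)` times; only squarefree `d ∣ n`, the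
divisors of the radical, give nonzero values. -/

theorem IsPrimitiveRoot.sum_primitiveRoots {K : Type*} [Field K] [CharZero K] [IsAlgClosed K]
    {n : ℕ} (hn : 0 < n) : ∑ z ∈ primitiveRoots n K, z = (ArithmeticFunction.moebius n : K) := by
  -- Möbius inversion: summed over the divisors of `m`, these sums give the sum of all `m`-th roots
  -- of unity, which is `0` unless `m = 1`.
  have h := (ArithmeticFunction.sum_eq_iff_sum_mul_moebius_eq (R := K)
    (f := fun n => ∑ z ∈ primitiveRoots n K, z) (g := fun n => if n = 1 then 1 else 0)).1 ?_ n hn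
  · rw [← h, Nat.sum_divisorsAntidiagonal
      (f := fun a b => (ArithmeticFunction.moebius a : K) * if b = 1 then 1 else 0),
      Finset.sum_eq_single n]
    · simp [Nat.div_self hn]
    · intro b hb hbn
      have : n / b ≠ 1 := fun h => hbn (Nat.eq_of_dvd_of_div_eq_one (Nat.dvd_of_mem_divisors hb) h)
      simp [this]
    · simp [hn.ne']
  · intro m hm
    classical
    have : NeZero m := ⟨hm.ne'⟩
    obtain ⟨ζ, hζ⟩ := HasEnoughRootsOfUnity.exists_primitiveRoot K m
    rw [← Finset.sum_biUnion, ← IsPrimitiveRoot.nthRoots_one_eq_biUnion_primitiveRoots]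
    · have : ∑ z ∈ Polynomial.nthRootsFinset m (1 : K), z = ∑ i ∈ range m, ζ ^ i := by
        symm
        refine Finset.sum_nbij (fun i => ζ ^ i) ?_ ?_ ?_ (fun _ _ => rfl)
        · intro i _
          rw [Polynomial.mem_nthRootsFinset hm, ← pow_mul, mul_comm, pow_mul, hζ.pow_eq_one,
            one_pow]
        · intro i hi j hj h
          exact hζ.pow_inj (by simpa using hi) (by simpa using hj) h
        · intro z hz
          obtain ⟨i, hi, rfl⟩ := hζ.eq_pow_of_pow_eq_one
            ((Polynomial.mem_nthRootsFinset hm 1).1 hz)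
          exact ⟨i, by simpa using hi, rfl⟩
      rw [this]
      split_ifs with h1
      · subst h1; simp
      · exact hζ.geom_sum_eq_zero (by omega)
    · intro a _ b _ hab
      exact IsPrimitiveRoot.disjoint hab

theorem IsPrimitiveRoot.sum_pow_units {n : ℕ} [NeZero n] {z : ℂ} (hz : IsPrimitiveRoot z n) :
    ∑ u : (ZMod n)ˣ, z ^ (u : ZMod n).val = ArithmeticFunction.moebius n := by
  rw [← IsPrimitiveRoot.sum_primitiveRoots (K := ℂ) (NeZero.pos n)]
  refine Finset.sum_nbij (fun u => z ^ (u : ZMod n).val) ?_ ?_ ?_ (fun _ _ => rfl)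
  · intro u _
    rw [mem_primitiveRoots (NeZero.pos n)]
    exact hz.pow_of_coprime _ (ZMod.val_coe_unit_coprime u)
  · intro u _ v _ h
    exact Units.ext (ZMod.val_injective n (hz.pow_inj (ZMod.val_lt _) (ZMod.val_lt _) h))
  · intro w hw
    obtain ⟨i, hi, hc, rfl⟩ := hz.isPrimitiveRoot_iff.1
      ((mem_primitiveRoots (NeZero.pos n)).1 (by simpa using hw))
    exact ⟨ZMod.unitOfCoprime i hc, by simp, by simp [ZMod.val_natCast_of_lt hi]⟩

/-- The summand depends only on `u` mod `d`, and reduction of units from `n` to `d` is surjective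
with fibres of equal size `φ(n)/φ(d)`. -/
theorem IsPrimitiveRoot.sum_pow_units_of_dvd {d n : ℕ} [NeZero n] (hd : d ∣ n) {z : ℂ}
    (hz : IsPrimitiveRoot z d) :
    ∑ u : (ZMod n)ˣ, z ^ (u : ZMod n).val =
      ArithmeticFunction.moebius d * ((Nat.totient n : ℂ) / Nat.totient d) := by
  classical
  have : NeZero d := ⟨fun h => NeZero.ne n (by simpa [h] using hd)⟩
  let f := ZMod.unitsMap hd
  let c := #{u | f u = 1}
  have hc (v : (ZMod d)ˣ) : #{u | f u = v} = c :=
    MonoidHom.card_fiber_eq_of_mem_range f (ZMod.unitsMap_surjective hd v) ⟨1, map_one f⟩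
  have hcard : n.totient = d.totient * c := by
    rw [← ZMod.card_units_eq_totient n, ← ZMod.card_units_eq_totient d, ← Finset.card_univ,
      Finset.card_eq_sum_card_fiberwise (f := f) (t := univ) (by simp)]
    simp [hc]
  have hval (u : (ZMod n)ˣ) : z ^ (u : ZMod n).val = z ^ (f u : ZMod d).val := by
    rw [ZMod.unitsMap_val, ZMod.cast_eq_val, ZMod.val_natCast]
    conv_lhs => rw [← Nat.mod_add_div (u : ZMod n).val d, pow_add, pow_mul, hz.pow_eq_one]
    simp
  have hd0 : (d.totient : ℂ) ≠ 0 := by simp [NeZero.ne d]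
  rw [Finset.sum_congr rfl fun u _ => hval u,
    ← Finset.sum_fiberwise_of_maps_to (s := univ) (t := univ) (g := f) (by simp), hcard]
  have : ∀ v : (ZMod d)ˣ, ∑ u with f u = v, z ^ (f u : ZMod d).val
      = c * z ^ (v : ZMod d).val := by
    intro v
    rw [Finset.sum_congr rfl (g := fun _ => z ^ (v : ZMod d).val), sum_const, hc, nsmul_eq_mul]
    intro u hu
    rw [(mem_filter.1 hu).2]
  rw [Finset.sum_congr rfl fun v _ => this v, ← mul_sum, hz.sum_pow_units]
  push_cast
  field_simp

theorem IsPrimitiveRoot.sum_pow_coprime {d n : ℕ} (hn : 0 < n) (hd : d ∣ n) {z : ℂ}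
    (hz : IsPrimitiveRoot z d) :
    ∑ a ∈ range n with a.Coprime n, z ^ a =
      ArithmeticFunction.moebius d * ((Nat.totient n : ℂ) / Nat.totient d) := by
  have : NeZero n := ⟨hn.ne'⟩
  rw [← hz.sum_pow_units_of_dvd hd]
  symm
  refine Finset.sum_nbij (fun u => (u : ZMod n).val) ?_ ?_ ?_ (fun _ _ => rfl)
  · intro u _
    simpa [ZMod.val_lt] using ZMod.val_coe_unit_coprime u
  · intro u _ v _ h
    exact Units.ext (ZMod.val_injective n h)
  · intro i hi
    obtain ⟨hi, hc⟩ : i < n ∧ i.Coprime n := by simpa using hi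
    exact ⟨ZMod.unitOfCoprime i hc, by simp, by simp [ZMod.val_natCast_of_lt hi]⟩

/-- The shift `a ↦ a + n` preserves coprimality to `n`, so a factor `1 + z ^ n` splits off; `z ^ n =
±1`, with sign `+` exactly when `d ∣ n`. -/
theorem IsPrimitiveRoot.sum_pow_coprime_two_mul {d n : ℕ} (hn : 0 < n) (hd : d ∣ 2 * n) {z : ℂ}
    (hz : IsPrimitiveRoot z d) :
    ∑ a ∈ range (2 * n) with a.Coprime n, z ^ a =
      if d ∣ n then
        2 * (ArithmeticFunction.moebius d : ℂ) * ((Nat.totient n : ℂ) / Nat.totient d)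
      else 0 := by
  have h : ∑ a ∈ range (2 * n) with a.Coprime n, z ^ a =
      (1 + z ^ n) * ∑ a ∈ range n with a.Coprime n, z ^ a := by
    simp only [sum_filter]
    rw [two_mul, sum_range_add, add_mul, one_mul, mul_sum]
    simp [pow_add]
  rw [h]
  split_ifs with hdn
  · rw [hz.sum_pow_coprime hn hdn, (hz.pow_eq_one_iff_dvd n).2 hdn]
    ring
  · have h1 : z ^ n ≠ 1 := fun h => hdn ((hz.pow_eq_one_iff_dvd n).1 h)
    have h2 : (z ^ n) ^ 2 = 1 := by
      rw [← pow_mul, mul_comm]; exact (hz.pow_eq_one_iff_dvd _).2 hd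
    rw [(sq_eq_sq_iff_eq_or_eq_neg.1 (h2.trans (one_pow 2).symm)).resolve_left h1]
    simp

/-- The discrete Fourier transform diagonalises a matrix depending only on `j - i`. -/
theorem ZMod.charpoly_of_sub {N : ℕ} [NeZero N] (c : ZMod N → ℂ) :
    (Matrix.of fun i j : ZMod N => c (j - i)).charpoly =
      ∏ k : ZMod N, (Polynomial.X - Polynomial.C (∑ a, c a * ZMod.stdAddChar k ^ a.val)) := by
  set ψ : AddChar (ZMod N) ℂ := ZMod.stdAddChar
  let F : Matrix (ZMod N) (ZMod N) ℂ := Matrix.of fun j k => ψ (j * k)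
  let G : Matrix (ZMod N) (ZMod N) ℂ := Matrix.of fun k j => (N : ℂ)⁻¹ * ψ (-(j * k))
  let D : Matrix (ZMod N) (ZMod N) ℂ := Matrix.diagonal fun k => ∑ a, c a * ψ k ^ a.val
  have hN : (N : ℂ) ≠ 0 := by simp [NeZero.ne N]
  have hFG : F * G = 1 := by
    ext i j
    simp only [F, G, Matrix.mul_apply, Matrix.of_apply]
    have : ∀ k, ψ (i * k) * ((N : ℂ)⁻¹ * ψ (-(j * k))) = (N : ℂ)⁻¹ * ψ (k * (i - j)) := by
      intro k
      rw [mul_left_comm, ← AddChar.map_add_eq_mul]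
      congr 2
      ring
    rw [sum_congr rfl fun k _ => this k, ← mul_sum,
      AddChar.sum_mulShift _ (ZMod.isPrimitive_stdAddChar N), Matrix.one_apply]
    simp only [sub_eq_zero, ZMod.card]
    split_ifs <;> simp [hN]
  have hGF : G * F = 1 := mul_eq_one_comm.1 hFG
  have hpow (k a : ZMod N) : ψ k ^ a.val = ψ (a * k) := by
    rw [← AddChar.map_nsmul_eq_pow, nsmul_eq_mul, ZMod.natCast_zmod_val]
  -- The columns of `F` are the characters, which are the eigenvectors.
  have hAF : (Matrix.of fun i j : ZMod N => c (j - i)) * F = F * D := by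
    ext i k
    rw [Matrix.mul_diagonal]
    simp only [F, Matrix.mul_apply, Matrix.of_apply, mul_sum]
    rw [← Equiv.sum_comp (Equiv.addLeft i)]
    refine sum_congr rfl fun a _ => ?_
    rw [hpow, Equiv.coe_addLeft, add_sub_cancel_left, add_mul, AddChar.map_add_eq_mul]
    ring
  let U : (Matrix (ZMod N) (ZMod N) ℂ)ˣ := ⟨F, G, hFG, hGF⟩
  have : (Matrix.of fun i j : ZMod N => c (j - i)) = U.val * D * U⁻¹.val := by
    change _ = F * D * G
    rw [← hAF, mul_assoc, hFG, mul_one]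
  rw [this, Matrix.coe_units_inv, Matrix.charpoly_units_conj, Matrix.charpoly_diagonal]

theorem ZMod.isPrimitiveRoot_stdAddChar {N : ℕ} [NeZero N] (k : ZMod N) :
    IsPrimitiveRoot (ZMod.stdAddChar k) (addOrderOf k) := by
  rw [IsPrimitiveRoot.iff_def]
  have h (l : ℕ) : ZMod.stdAddChar k ^ l = 1 ↔ addOrderOf k ∣ l := by
    rw [← AddChar.map_nsmul_eq_pow, addOrderOf_dvd_iff_nsmul_eq_zero,
      ← ZMod.injective_stdAddChar.eq_iff, AddChar.map_zero_eq_one]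
  exact ⟨(h _).2 dvd_rfl, fun l => (h l).1⟩

theorem ZMod.sum_addOrderOf {M : Type*} [AddCommMonoid M] {N : ℕ} [NeZero N] (f : ℕ → M) :
    ∑ k : ZMod N, f (addOrderOf k) = ∑ d ∈ N.divisors, d.totient • f d := by
  have hdvd (k : ZMod N) : addOrderOf k ∣ N := by
    simpa using addOrderOf_dvd_card (x := k)
  rw [← Finset.sum_fiberwise_of_maps_to (s := univ) (t := N.divisors)
    (g := fun k : ZMod N => addOrderOf k) (by simp [hdvd, NeZero.ne N])]
  refine sum_congr rfl fun d hd => ?_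
  rw [sum_congr rfl (g := fun _ => f d), sum_const,
    IsAddCyclic.card_addOrderOf_eq_totient (by simpa using Nat.dvd_of_mem_divisors hd)]
  intro k hk
  rw [(mem_filter.1 hk).2]

theorem UniqueFactorizationMonoid.dvd_radical_iff_squarefree {d n : ℕ} (hn : n ≠ 0) :
    d ∣ radical n ↔ Squarefree d ∧ d ∣ n := by
  constructor
  · intro h
    exact ⟨squarefree_radical.squarefree_of_dvd h, h.trans radical_dvd_self⟩
  · rintro ⟨h, hd⟩
    exact (dvd_radical_iff h.isRadical hn).2 hd

/-- Sum of weighted contributions over all divisors of `2 * n`, where only squarefree divisors of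
`n` have a nonzero value. -/
theorem sum_totient_replicate_divisors {n : ℕ} (hn : 0 < n) (f : ℕ → ℝ)
    (hf : ∀ d, ¬ (d ∣ n ∧ Squarefree d) → f d = 0) :
    ∑ d ∈ (2 * n).divisors, d.totient • ({f d} : Multiset ℝ) =
      Multiset.replicate (2 * n - UniqueFactorizationMonoid.radical n) (0 : ℝ)
        + Multiset.replicate 1 (f 1)
        + ∑ d ∈ (UniqueFactorizationMonoid.radical n).divisors with 1 < d,
            Multiset.replicate d.totient (f d) := by
  set r := UniqueFactorizationMonoid.radical n with hr
  have hr0 : r ≠ 0 := UniqueFactorizationMonoid.radical_ne_zero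
  have hrn : r ∣ 2 * n := UniqueFactorizationMonoid.radical_dvd_self.trans (dvd_mul_left n 2)
  have hsub : r.divisors ⊆ (2 * n).divisors := Nat.divisors_subset_of_dvd (by omega) hrn
  have htot : ∑ d ∈ (2 * n).divisors \ r.divisors, d.totient = 2 * n - r := by
    have := sum_sdiff (f := Nat.totient) hsub
    rw [Nat.sum_totient, Nat.sum_totient] at this
    omega
  have hzero : ∑ d ∈ (2 * n).divisors \ r.divisors, d.totient • ({f d} : Multiset ℝ) =
      Multiset.replicate (2 * n - r) 0 := by
    rw [← htot, ← Multiset.nsmul_singleton, sum_smul]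
    refine sum_congr rfl fun d hd => ?_
    rw [hf d]
    rintro ⟨h1, h2⟩
    exact (mem_sdiff.1 hd).2 (Nat.mem_divisors.2
      ⟨(UniqueFactorizationMonoid.dvd_radical_iff_squarefree hn.ne').2 ⟨h2, h1⟩, hr0⟩)
  have hone : r.divisors.filter (¬ 1 < ·) = {1} := by
    ext d
    simp only [mem_filter, Nat.mem_divisors, mem_singleton]
    constructor
    · rintro ⟨⟨h, _⟩, h1⟩
      have := Nat.pos_of_dvd_of_pos h (Nat.pos_of_ne_zero hr0)
      omega
    · rintro rfl
      simp [hr0]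
  rw [← sum_sdiff hsub, hzero, ← sum_filter_add_sum_filter_not r.divisors (1 < ·), hone,
    sum_singleton]
  simp only [Multiset.nsmul_singleton, Nat.totient_one]
  abel

/-! ### Generating pairs in the dicyclic group -/

namespace QuaternionGroup

/-- The elements `a k` with `k ≡ 0` and `xa k` with `k ≡ i` modulo a divisor `g` of `n`. -/
def congrSubgroup {n g : ℕ} (hg : g ∣ n) (i : ZMod (2 * n)) : Subgroup (QuaternionGroup n) where
  carrier := {q | match q with
    | a k => ZMod.castHom (hg.mul_left 2) (ZMod g) k = 0
    | xa k => ZMod.castHom (hg.mul_left 2) (ZMod g) (k - i) = 0}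
  one_mem' := map_zero (ZMod.castHom (hg.mul_left 2) (ZMod g))
  mul_mem' := by
    -- The product of two `xa` elements carries a shift by `n`, which vanishes mod `g`.
    have hn : (n : ZMod g) = 0 := (ZMod.natCast_eq_zero_iff n g).2 hg
    rintro (k | k) (l | l) hk hl <;>
      simp only [Set.mem_ofPred_eq, a_mul_a, a_mul_xa, xa_mul_a, xa_mul_xa, map_add, map_sub,
        map_natCast, hn] at hk hl ⊢ <;>
      first | linear_combination hl + hk | linear_combination hl - hk
  inv_mem' := by
    have hn : (n : ZMod g) = 0 := (ZMod.natCast_eq_zero_iff n g).2 hg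
    rintro (k | k) hk
    · change ZMod.castHom (hg.mul_left 2) (ZMod g) (-k) = 0
      rw [map_neg, neg_eq_zero]
      exact hk
    · change ZMod.castHom (hg.mul_left 2) (ZMod g) (n + k - i) = 0
      rw [add_sub_assoc, map_add, map_natCast, hn, zero_add]
      exact hk

theorem a_mem_congrSubgroup {n g : ℕ} (hg : g ∣ n) (i k : ZMod (2 * n)) :
    a k ∈ congrSubgroup hg i ↔ ZMod.castHom (hg.mul_left 2) (ZMod g) k = 0 := Iff.rfl

theorem xa_mem_congrSubgroup {n g : ℕ} (hg : g ∣ n) (i k : ZMod (2 * n)) :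
    xa k ∈ congrSubgroup hg i ↔ ZMod.castHom (hg.mul_left 2) (ZMod g) (k - i) = 0 := Iff.rfl

theorem a_zpow {n : ℕ} (k : ZMod (2 * n)) (m : ℤ) : a k ^ m = a ((m : ZMod (2 * n)) * k) := by
  let f : Multiplicative (ZMod (2 * n)) →* QuaternionGroup n :=
    { toFun := fun k => a k.toAdd, map_one' := rfl, map_mul' := fun _ _ => rfl }
  have := map_zpow f (Multiplicative.ofAdd k) m
  rw [← ofAdd_zsmul, zsmul_eq_mul] at this
  exact this.symm

theorem closure_xa_xa_eq_top_iff {n : ℕ} [NeZero n] (i j : ZMod (2 * n)) :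
    Subgroup.closure {xa i, xa j} = ⊤ ↔ (j - i).val.Coprime n := by
  constructor
  · intro h
    set g := (j - i).val.gcd n with hg
    have hgn : g ∣ n := Nat.gcd_dvd_right _ _
    have hle : Subgroup.closure {xa i, xa j} ≤ congrSubgroup hgn i := by
      rw [Subgroup.closure_le]
      rintro q (rfl | rfl)
      · exact (xa_mem_congrSubgroup ..).2 (by simp)
      · refine (xa_mem_congrSubgroup ..).2 ?_
        rw [← ZMod.natCast_zmod_val (j - i), map_natCast, ZMod.natCast_eq_zero_iff]
        exact Nat.gcd_dvd_left _ _
    have h1 : a 1 ∈ congrSubgroup hgn i := hle (h ▸ Subgroup.mem_top _)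
    rw [a_mem_congrSubgroup, map_one, ← Nat.cast_one, ZMod.natCast_eq_zero_iff] at h1
    exact Nat.dvd_one.1 h1
  · intro h
    set H := Subgroup.closure {xa i, xa j}
    have hi : xa i ∈ H := Subgroup.subset_closure (by simp)
    have hj : xa j ∈ H := Subgroup.subset_closure (by simp)
    -- Since `a n` comes for free as a square, Bézout with `n` rather than `2n` suffices to reach `a
    -- 1`.
    have hn : a n ∈ H := by simpa using H.pow_mem hi 2
    have hd : a (j - i) ∈ H := by
      have := H.mul_mem (H.inv_mem hn) (H.mul_mem hi hj)
      rwa [xa_mul_xa, add_sub_assoc, ← a_mul_a, inv_mul_cancel_left] at this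
    have h1 : a 1 ∈ H := by
      have hb := Nat.gcd_eq_gcd_ab (j - i).val n
      rw [Nat.Coprime.gcd_eq_one h] at hb
      have hc := congrArg (Int.cast : ℤ → ZMod (2 * n)) hb
      push_cast [ZMod.natCast_zmod_val] at hc
      rw [hc, ← a_mul_a, mul_comm (j - i), mul_comm (n : ZMod (2 * n)), ← a_zpow, ← a_zpow]
      exact H.mul_mem (H.zpow_mem hd _) (H.zpow_mem hn _)
    have ha (k : ZMod (2 * n)) : a k ∈ H := by
      have := H.pow_mem h1 k.val
      rwa [a_one_pow, ZMod.natCast_zmod_val] at this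
    rw [eq_top_iff]
    rintro (k | k) -
    · exact ha k
    · have := H.mul_mem hi (ha (k - i))
      rwa [xa_mul_a, add_sub_cancel] at this

end QuaternionGroup

namespace Dicyclic

theorem mem_Omega_iff {n : ℕ} [NeZero n] {g : QuaternionGroup n} :
    g ∈ Omega n ↔ ∃ i, g = QuaternionGroup.xa i := by
  have h (b : ℕ) : x n ^ b * y n = QuaternionGroup.xa (-b) := by
    rw [x, y, QuaternionGroup.a_one_pow, QuaternionGroup.a_mul_xa, zero_sub]
  constructor
  · rintro ⟨b, -, rfl⟩
    exact ⟨_, h b⟩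
  · rintro ⟨i, rfl⟩
    exact ⟨(-i).val, ZMod.val_lt _, by rw [h, ZMod.natCast_zmod_val, neg_neg]⟩

/-- The elements of `Ω`, indexed by residues modulo `2n`. -/
noncomputable def omegaEquiv (n : ℕ) [NeZero n] : ZMod (2 * n) ≃ Omega n :=
  Equiv.ofBijective (fun i => ⟨QuaternionGroup.xa i, mem_Omega_iff.2 ⟨i, rfl⟩⟩)
    ⟨fun i j h => QuaternionGroup.xa.inj (congrArg Subtype.val h), fun ⟨_, hg⟩ => by
      obtain ⟨i, rfl⟩ := mem_Omega_iff.1 hg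
      exact ⟨i, rfl⟩⟩

theorem graphOmega_adj_iff {n : ℕ} (hn : 2 ≤ n) [NeZero n] (i j : ZMod (2 * n)) :
    (graphOmega n).Adj (omegaEquiv n i) (omegaEquiv n j) ↔ (j - i).val.Coprime n := by
  rw [← QuaternionGroup.closure_xa_xa_eq_top_iff]
  refine ⟨fun h => h.2, fun h => ⟨fun hij => ?_, h⟩⟩
  have hij : i = j := QuaternionGroup.xa.inj hij
  -- Equal vertices would make `0` coprime to `n`, forcing `n = 1`.
  rw [QuaternionGroup.closure_xa_xa_eq_top_iff, hij, sub_self, ZMod.val_zero,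
    Nat.coprime_zero_left] at h
  omega

end Dicyclic

theorem mainTheorem7 (n : ℕ) (hn : 2 ≤ n) [Fintype (Dicyclic.Omega n)]
    [DecidableEq (Dicyclic.Omega n)] [DecidableRel (Dicyclic.graphOmega n).Adj] :
    ((Dicyclic.graphOmega n).adjMatrix ℝ).charpoly.roots =
      Multiset.replicate (2 * n - UniqueFactorizationMonoid.radical n) (0 : ℝ)
        + Multiset.replicate 1 (2 * (Nat.totient n : ℝ))
        + ∑ d ∈ (UniqueFactorizationMonoid.radical n).divisors with 1 < d,
            Multiset.replicate (Nat.totient d)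
              (2 * (ArithmeticFunction.moebius d : ℝ) * ((Nat.totient n : ℝ) / (Nat.totient d : ℝ)))

    := by
  have : NeZero n := ⟨by omega⟩
  let f : ℕ → ℝ := fun d => if d ∣ n then
    2 * (ArithmeticFunction.moebius d : ℝ) * ((Nat.totient n : ℝ) / Nat.totient d) else 0
  have hchar : ((Dicyclic.graphOmega n).adjMatrix ℝ).charpoly =
      ∏ k : ZMod (2 * n), (Polynomial.X - Polynomial.C (f (addOrderOf k))) := by
    -- The characters live over `ℂ`, but the eigenvalues are real, so the factorisation descends.
    apply Polynomial.map_injective Complex.ofRealHom Complex.ofReal_injective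
    rw [← Matrix.charpoly_reindex (Dicyclic.omegaEquiv n).symm, ← Matrix.charpoly_map,
      Polynomial.map_prod]
    let c : ZMod (2 * n) → ℂ := fun a => if a.val.Coprime n then 1 else 0
    have hM : (Matrix.reindex (Dicyclic.omegaEquiv n).symm (Dicyclic.omegaEquiv n).symm
        ((Dicyclic.graphOmega n).adjMatrix ℝ)).map Complex.ofRealHom =
        Matrix.of fun i j => c (j - i) := by
      ext i j
      simp only [Matrix.map_apply, Matrix.reindex_apply, Matrix.submatrix_apply, Equiv.symm_symm,
        SimpleGraph.adjMatrix_apply, Dicyclic.graphOmega_adj_iff hn, Matrix.of_apply, c]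
      split_ifs <;> simp
    rw [hM, ZMod.charpoly_of_sub]
    refine prod_congr rfl fun k _ => ?_
    have hk : addOrderOf k ∣ 2 * n := by simpa using addOrderOf_dvd_card (x := k)
    have hsum : ∑ a, c a * ZMod.stdAddChar k ^ a.val = (f (addOrderOf k) : ℂ) := by
      have h := (ZMod.isPrimitiveRoot_stdAddChar k).sum_pow_coprime_two_mul (NeZero.pos n) hk
      have hf : (f (addOrderOf k) : ℂ) =
          ∑ a ∈ range (2 * n) with a.Coprime n, ZMod.stdAddChar k ^ a := by
        rw [h]
        simp only [f, apply_ite Complex.ofReal]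
        push_cast
        rfl
      rw [hf]
      simp only [c, ite_mul, one_mul, zero_mul, ← sum_filter]
      refine Finset.sum_nbij ZMod.val ?_ ?_ ?_ (fun _ _ => rfl)
      · intro a ha
        simpa [ZMod.val_lt] using ha
      · exact (ZMod.val_injective _).injOn
      · intro a ha
        obtain ⟨ha, hc⟩ : a < 2 * n ∧ a.Coprime n := by simpa using ha
        exact ⟨a, by simpa [ZMod.val_natCast_of_lt ha] using hc, ZMod.val_natCast_of_lt ha⟩
    rw [hsum]
    simp
  have hroots : ((Dicyclic.graphOmega n).adjMatrix ℝ).charpoly.roots =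
      ∑ k : ZMod (2 * n), {f (addOrderOf k)} := by
    rw [hchar, Polynomial.roots_prod]
    · simp only [Polynomial.roots_X_sub_C]
      rfl
    · exact prod_ne_zero_iff.2 fun k _ => Polynomial.X_sub_C_ne_zero _
  rw [hroots, ZMod.sum_addOrderOf (fun d => ({f d} : Multiset ℝ)),
    sum_totient_replicate_divisors (NeZero.pos n) f]
  · congr 1
    · simp [f]
    · refine sum_congr rfl fun d hd => ?_
      have hdn : d ∣ n := (Nat.dvd_of_mem_divisors (mem_filter.1 hd).1).trans
        UniqueFactorizationMonoid.radical_dvd_self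
      simp [f, hdn]
  · intro d hd
    simp only [f]
    split_ifs with h
    · rw [ArithmeticFunction.moebius_eq_zero_of_not_squarefree fun hs => hd ⟨h, hs⟩]
      simp
    · rfl
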